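/- Let $F^2_d=\bigoplus_{k\ge 0}(\mathbb C^d)^{\otimes k}$ be the full Fock space, with canonical orthonormal basis $(e_\alpha)$ indexed by the words $\alpha$ in $d$ letters and with vacuum vector $1=e_\emptyset$. Let $L_k f=e_k\otimes f$ be the left creation operators and $\operatorname{ran}L=\sum_k L_kF^2_d$. Let $\mathbb B^d_{\mathbb N}$ be the set of all $d$-tuples $Z=(Z_1,\dots,Z_d)$ of complex $n\times n$ matrices, $n\ge 1$, for which the row $(Z_1,\dots,Z_d)$ is a strict contraction. Identify $x=\sum_\alpha x_\alpha e_\alpha\in F^2_d$ with the function $x(Z)=\sum_\alpha x_\alpha Z^\alpha$ on $\mathbb B^d_{\mathbb N}$. A free function $G$ on $\mathbb B^d_{\mathbb N}$ (a graded matrix-valued function that respects intertwinings) is a right multiplier if for each $x\in F^2_d$ the function $x(Z)G(Z)$ belongs to $F^2_d$; this defines $M^R_G:F^2_d\to F^2_d$. It is outer if $\operatorname{ran}M^R_G$ is dense. If $A$ is an outer right multiplier, then $A(Z)$ is invertible for all $Z\in\mathbb B^d_{\mathbb N}$. The right free Smirnov functions are the functions $A(Z)^{-1}B(Z)$ with $A$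 an outer right multiplier and $B$ a right multiplier. Let $T:\operatorname{dom}T\subseteq F^2_d\to F^2_d$ be a closed linear transformation with $L_k\operatorname{dom}T\subseteq\operatorname{dom}T$ and $TL_kx=L_kTx$ for all $x\in\operatorname{dom}T$ and $1\le k\le d$, and suppose that $1\notin(\operatorname{dom}T)^\perp$ (that is, $T\lesssim R^\infty_d$). Let $G(T)=\{x\oplus Tx : x\in\operatorname{dom}T\}\subseteq F^2_d\oplus F^2_d$ be the graph of $T$, let $X:G(T)\to F^2_d$ be the map $X(x\oplus Tx)=x$, with Hilbert space adjoint $X^*$, and let $G(T)\ominus\sum_k(L_k\oplus L_k)G(T)$ be the wandering space of $G(T)$. Then the following are equivalent: 1. $T$ is local: if $x\in\operatorname{dom}T\cap\operatorname{ran}L$, then $L_k^*x\in\operatorname{dom}T$ for all $k$. 2. $X^*1$ spans the wandering space of $G(T)$. If $T$ is also densely defined, then (1) and (2) are equivalent to 3. $T$ is right-Smirnov: there are an outer right multiplier $A$ and a right multiplier $B$ with $T=M^R_B(M^R_A)^{-1}$; that is, $\operatorname{dom}T=\operatorname{ran}M^R_A$ and $(Tx)(Z)=x(Z)A(Z)^{-1}B(Z)$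 for all $x\in\operatorname{dom}T$ and $Z\in\mathbb B^d_{\mathbb N}$. In particular, if $T$ is densely defined and is right multiplication by a right free Smirnov function $F$ on its maximal domain $\{x\in F^2_d : x(Z)F(Z)\in F^2_d\}$, then (1), (2) and (3) hold. -/

import Mathlib

noncomputable section

namespace FreeSmirnov

/-! ### The full Fock space and the left free shift -/

/-- The full Fock space over `ℂ^d`, in the coordinates of its canonical orthonormal basis
`(e_α)`, where `α` runs over the free monoid on `d` letters. -/
abbrev Fock (d : ℕ) : Type := lp (fun _ : FreeMonoid (Fin d) => ℂ) 2

instance instDecidableEqWord (d : ℕ) : DecidableEq (FreeMonoid (Fin d)) :=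
  inferInstanceAs (DecidableEq (List (Fin d)))

/-- The canonical basis vector `e_α`. -/
def e {d : ℕ} (α : FreeMonoid (Fin d)) : Fock d := lp.single 2 α (1 : ℂ)

/-- The vacuum vector `1 = e_∅`. -/
def vac (d : ℕ) : Fock d := e 1

theorem orthonormal_e (d : ℕ) : Orthonormal ℂ (e : FreeMonoid (Fin d) → Fock d) := by
  rw [orthonormal_iff_ite]
  intro α β
  by_cases h : α = β
  · subst h; simp [e]
  · simp [e, lp.inner_single_left, h]

theorem orthonormal_e_of_mul {d : ℕ} (k : Fin d) :
    Orthonormal ℂ (fun α : FreeMonoid (Fin d) => (e (FreeMonoid.of k * α) : Fock d)) :=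
  (orthonormal_e d).comp _ (mul_right_injective (FreeMonoid.of k))

/-- The left creation operator `L_k f = e_k ⊗ f`: the isometry which sends every basis vector
`e_α` to `e_{kα}`. -/
def L {d : ℕ} (k : Fin d) : Fock d →L[ℂ] Fock d :=
  (orthonormal_e_of_mul k).orthogonalFamily.linearIsometry.toContinuousLinearMap

theorem L_e {d : ℕ} (k : Fin d) (α : FreeMonoid (Fin d)) :
    L k (e α : Fock d) = e (FreeMonoid.of k * α) := by
  change (orthonormal_e_of_mul k).orthogonalFamily.linearIsometry (lp.single 2 α (1 : ℂ)) = _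
  rw [OrthogonalFamily.linearIsometry_apply_single]
  simp

/-- The range of the left free shift `L = (L_1, …, L_d) : F² ⊗ ℂ^d → F²`. -/
def ranL (d : ℕ) : Submodule ℂ (Fock d) := ⨆ k : Fin d, (L k).range

/-! ### Closed linear transformations affiliated to the right free shift -/

/-- `T` is affiliated to the right free shift, `T L ⊆ L (T ⊗ I_d)` in the sense that for all `k`,
`L_k dom T ⊆ dom T` and `T L_k x = L_k T x` for `x ∈ dom T`. -/
def IsAffiliated {d : ℕ} (T : Fock d →ₗ.[ℂ] Fock d) : Prop :=
  ∀ (k : Fin d) (x : T.domain), ∃ h : L k (x : Fock d) ∈ T.domain, T ⟨L k x, h⟩ = L k (T x)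

/-- `T ≲ R^∞_d`: `T` is affiliated to the right free shift, closed, and `1 ∉ (dom T)^⊥`. -/
structure LesssimR {d : ℕ} (T : Fock d →ₗ.[ℂ] Fock d) : Prop where
  affiliated : IsAffiliated T
  closed : T.IsClosed
  vac_notMem : vac d ∉ T.domainᗮ

/-- `T` is densely defined; together with `T ≲ R^∞_d` this is `T ∼ R^∞_d`. -/
def IsDenselyDefined {d : ℕ} (T : Fock d →ₗ.[ℂ] Fock d) : Prop :=
  Dense (T.domain : Set (Fock d))

/-- `T` is local: `dom T ∩ ran L` is `L*`-invariant, i.e. `L_k^* x ∈ dom T` for all `k` whenever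
`x ∈ dom T ∩ ran L`. -/
def IsLocal {d : ℕ} (T : Fock d →ₗ.[ℂ] Fock d) : Prop :=
  ∀ x ∈ T.domain, x ∈ ranL d → ∀ k : Fin d, ContinuousLinearMap.adjoint (L k) x ∈ T.domain

/-! ### The graph, the map `X`, and the wandering space -/

/-- The Hilbert space `F² ⊕ F² = F² ⊗ ℂ²`. -/
abbrev Fock2 (d : ℕ) : Type := WithLp 2 (Fock d × Fock d)

/-- The graph `G(T) = {x ⊕ T x}` as a subspace of the Hilbert space `F² ⊕ F²`. -/
def G {d : ℕ} (T : Fock d →ₗ.[ℂ] Fock d) : Submodule ℂ (Fock2 d) :=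
  T.graph.comap (WithLp.linearEquiv 2 ℂ (Fock d × Fock d)).toLinearMap

theorem isClosed_G {d : ℕ} {T : Fock d →ₗ.[ℂ] Fock d} (hT : T.IsClosed) :
    IsClosed (G T : Set (Fock2 d)) :=
  IsClosed.preimage (WithLp.prodContinuousLinearEquiv 2 ℂ (Fock d) (Fock d)).continuous hT

/-- The operator `L_k ⊗ I_2` on `F² ⊗ ℂ²`. -/
def L2 {d : ℕ} (k : Fin d) : Fock2 d →L[ℂ] Fock2 d :=
  ((WithLp.prodContinuousLinearEquiv 2 ℂ (Fock d) (Fock d)).symm : _ →L[ℂ] Fock2 d) ∘L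
    ((L k).prodMap (L k)) ∘L
      ((WithLp.prodContinuousLinearEquiv 2 ℂ (Fock d) (Fock d)) : Fock2 d →L[ℂ] _)

theorem L2_apply {d : ℕ} (k : Fin d) (x y : Fock d) :
    L2 k (WithLp.toLp 2 (x, y)) = WithLp.toLp 2 (L k x, L k y) := rfl

/-- The wandering space `G(T) ⊖ (L ⊗ I_2)(G(T) ⊗ ℂ^d)` of the restriction of `L ⊗ I_2` to
`G(T)`. -/
def wanderingSpace {d : ℕ} (T : Fock d →ₗ.[ℂ] Fock d) : Submodule ℂ (Fock2 d) :=
  G T ⊓ (⨆ k : Fin d, (G T).map (L2 k).toLinearMap)ᗮ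

/-- The map `X : G(T) → F²`, `X (x ⊕ T x) = x`. -/
def X {d : ℕ} (T : Fock d →ₗ.[ℂ] Fock d) : G T →L[ℂ] Fock d :=
  (WithLp.fstL 2 ℂ (Fock d) (Fock d)) ∘L (G T).subtypeL

/-- The Hilbert space adjoint `X* : F² → G(T)`, for closed `T` (so that `G(T)` is complete). -/
def Xstar {d : ℕ} (T : Fock d →ₗ.[ℂ] Fock d) (hT : T.IsClosed) : Fock d →L[ℂ] G T :=
  haveI : CompleteSpace (G T) := (isClosed_G hT).completeSpace_coe
  ContinuousLinearMap.adjoint (X T)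

/-- `X* 1` spans the wandering space of `G(T)`. -/
def XstarVacSpans {d : ℕ} (T : Fock d →ₗ.[ℂ] Fock d) (hT : T.IsClosed) : Prop :=
  Submodule.span ℂ {(Xstar T hT (vac d) : Fock2 d)} = wanderingSpace T

/-! ### The free Hardy space -/

section Ball

open scoped Matrix.Norms.L2Operator

/-- The open non-commutative unit ball at level `n`: the `d`-tuples of complex `n × n` matrices
for which the row `(Z_1, …, Z_d)` is a strict contraction for the operator norm. -/
def ball (d n : ℕ) : Set (Fin d → Matrix (Fin n) (Fin n) ℂ) :=
  {Z | ‖(Matrix.of fun i (p : Fin d × Fin n) => Z p.1 i p.2 :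
    Matrix (Fin n) (Fin d × Fin n) ℂ)‖ < 1}

end Ball

/-- Graded matrix-valued functions of `d` matrix variables. Only their values on the
non-commutative unit ball are ever used. -/
abbrev NCMap (d : ℕ) : Type :=
  (n : ℕ) → (Fin d → Matrix (Fin n) (Fin n) ℂ) → Matrix (Fin n) (Fin n) ℂ

/-- `F` is a free (non-commutative) function on the unit ball: it respects intertwinings. -/
def IsFree {d : ℕ} (F : NCMap d) : Prop :=
  ∀ (n m : ℕ), ∀ Z ∈ ball d n, ∀ W ∈ ball d m, ∀ S : Matrix (Fin n) (Fin m) ℂ,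
    (∀ j, Z j * S = S * W j) → F n Z * S = S * F m W

/-- The function `f_x(Z) = ∑_α x_α Z^α` on the ball given by `x ∈ F²`, where
`Z^α = Z_{i_1} ⋯ Z_{i_k}` for `α = i_1 ⋯ i_k`. The series converges absolutely on the ball. These
functions are the elements of the free Hardy space. -/
def eval {d : ℕ} (x : Fock d) : NCMap d :=
  fun _ Z => ∑' α : FreeMonoid (Fin d), x α • FreeMonoid.lift Z α

/-- `y(Z) = x(Z) F(Z)` on the ball. -/
def IsRightProduct {d : ℕ} (F : NCMap d) (x y : Fock d) : Prop :=
  ∀ n, ∀ Z ∈ ball d n, eval y n Z = eval x n Z * F n Z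

/-- `F` is a right free multiplier of the free Hardy space. -/
structure IsRightMultiplier {d : ℕ} (F : NCMap d) : Prop where
  free : IsFree F
  mul : ∀ x : Fock d, ∃ y : Fock d, IsRightProduct F x y

/-- The range of the operator `M^R_F` of right multiplication by the right free multiplier `F`. -/
def ranMul {d : ℕ} (F : NCMap d) : Set (Fock d) :=
  {y | ∃ x : Fock d, IsRightProduct F x y}

/-- `F` is an outer right free multiplier: `M^R_F` has dense range. -/
structure IsRightOuter {d : ℕ} (F : NCMap d) : Prop where
  multiplier : IsRightMultiplier F
  dense : Dense (ranMul F)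

/-- The quotient `A(Z)⁻¹ B(Z)`. If `A` is an outer right multiplier, then `A(Z)` is invertible at
every point of the ball. The right free Smirnov class consists of the functions `quot A B` with
`B` a right multiplier and `A` an outer right multiplier. -/
def quot {d : ℕ} (A B : NCMap d) : NCMap d := fun n Z => (A n Z)⁻¹ * B n Z

/-- `T` acts on its domain as right multiplication by `F`: `(T x)(Z) = x(Z) F(Z)` for
`x ∈ dom T`. -/
def ActsAsRightMul {d : ℕ} (T : Fock d →ₗ.[ℂ] Fock d) (F : NCMap d) : Prop :=
  ∀ x : T.domain, IsRightProduct F (x : Fock d) (T x)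

/-- `T` is right-Smirnov: densely defined and `T = M^R_B (M^R_A)⁻¹` for a right multiplier `B` and
an outer right multiplier `A`. That is, `dom T = ran M^R_A`, and `T` acts as right multiplication
by the right free Smirnov function `A(Z)⁻¹ B(Z)`. -/
def IsRightSmirnov {d : ℕ} (T : Fock d →ₗ.[ℂ] Fock d) : Prop :=
  IsDenselyDefined T ∧ ∃ A B : NCMap d, IsRightOuter A ∧ IsRightMultiplier B ∧
    (T.domain : Set (Fock d)) = ranMul A ∧ ActsAsRightMul T (quot A B)

/-- `T` is right multiplication by a right free Smirnov function `F` on its maximal domain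
`{x ∈ F² : x(Z) F(Z) ∈ F²}`. -/
def IsMaximalSmirnovMul {d : ℕ} (T : Fock d →ₗ.[ℂ] Fock d) : Prop :=
  ∃ A B : NCMap d, IsRightOuter A ∧ IsRightMultiplier B ∧
    (∀ x : Fock d, x ∈ T.domain ↔ ∃ y : Fock d, IsRightProduct (quot A B) x y) ∧
    ActsAsRightMul T (quot A B)

end FreeSmirnov

end

noncomputable section

namespace FreeSmirnov

open ContinuousLinearMap (adjoint)

variable {d : ℕ}

/-! ### Coordinates on the full Fock space -/

/-! Everything happens in G(T), a closed subspace invariant under the isometries L_k ⊕ L_k, whose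
ranges are mutually orthogonal. On G(T), X*1 represents the functional x ⊕ Tx ↦ x_∅ (`inner_xvac`).
It is wandering because this functional kills shifted vectors, and nonzero because 1 ∉ (dom T)^⊥. So
(2) says that a wandering vector whose first component has no vacuum coefficient is zero; as the
shifted part of G(T) is closed, this means that every x ⊕ Tx with x_∅ = 0 is a sum of shifted graph
vectors. That is locality: if all L_k^*x lie in dom T, shifting the graph vectors over them and
summing gives a graph vector over x, and a graph has only one; conversely, L_k^* reads the summands
off such a sum.

For (2) → (3), Wold decomposition: the translates of w = X*1/‖X*1‖ are an orthonormal basis of G(T),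
so e_α ↦ (L ⊕ L)^α w extends to a unitary F² → G(T). Its two components are right multiplications by
a(Z) and b(Z), where w = a ⊕ b. Hence dom T = ran M_a, and density of dom T is outerness of a.

For (3) → (1), and likewise for maximal domains, the point is that Σ Z_k g_k(Z) = 0 forces all g_k =
0 for free functions (`eq_zero_of_sum_mul_eq_zero`). A relation y(Z) = x(Z)F(Z) without vacuum
coefficients thus descends to L_k^*x and L_k^*y, and membership in either kind of domain is such a
relation. -/

theorem inner_e_left (α : FreeMonoid (Fin d)) (x : Fock d) : inner ℂ (e α) x = x α := by
  simp [e, lp.inner_single_left]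

theorem e_apply (α β : FreeMonoid (Fin d)) : (e α : Fock d) β = if β = α then 1 else 0 := by
  simp [e, Pi.single_apply]

theorem hasSum_smul_e (x : Fock d) : HasSum (fun α => x α • (e α : Fock d)) x := by
  have h := lp.hasSum_single (p := 2) (by norm_num) x
  convert! h using 2 with α
  rw [e, ← lp.single_smul]
  simp

/-- A continuous linear map on the Fock space is determined by its values on the basis. -/
theorem clm_ext_e {E : Type*} [AddCommMonoid E] [Module ℂ E] [TopologicalSpace E] [T2Space E]
    {f g : Fock d →L[ℂ] E} (h : ∀ α, f (e α) = g (e α)) : f = g := by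
  ext x
  have hf := f.hasSum (hasSum_smul_e x)
  have hg := g.hasSum (hasSum_smul_e x)
  simp only [map_smul, h] at hf hg
  exact hf.unique hg

theorem inner_L_L (k : Fin d) (x y : Fock d) : inner ℂ (L k x) (L k y) = inner ℂ x y :=
  (orthonormal_e_of_mul k).orthogonalFamily.linearIsometry.inner_map_map x y

theorem of_mul_inj (j k : Fin d) (α β : FreeMonoid (Fin d)) :
    FreeMonoid.of j * α = FreeMonoid.of k * β ↔ j = k ∧ α = β :=
  List.cons_eq_cons

theorem one_ne_of_mul (k : Fin d) (α : FreeMonoid (Fin d)) :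
    (1 : FreeMonoid (Fin d)) ≠ FreeMonoid.of k * α :=
  (List.cons_ne_nil k α).symm

/-- The coordinate functional `x ↦ x_α`. -/
def coord (α : FreeMonoid (Fin d)) : Fock d →L[ℂ] ℂ := innerSL ℂ (e α)

theorem coord_apply (α : FreeMonoid (Fin d)) (x : Fock d) : coord α x = x α :=
  inner_e_left α x

@[simp]
theorem L_apply_one (k : Fin d) (x : Fock d) : L k x 1 = 0 := by
  have : coord 1 ∘L L k = 0 := clm_ext_e fun α => by
    simp [coord_apply, L_e, e_apply, one_ne_of_mul]
  simpa [coord_apply] using congr($this x)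

theorem L_apply_of_mul (k j : Fin d) (x : Fock d) (α : FreeMonoid (Fin d)) :
    L k x (FreeMonoid.of j * α) = if j = k then x α else 0 := by
  have : coord (FreeMonoid.of j * α) ∘L L k = (if j = k then 1 else 0 : ℂ) • coord α :=
    clm_ext_e fun β => by
      split_ifs with h <;> simp [coord_apply, L_e, e_apply, of_mul_inj, h]
  have h := congr($this x)
  split_ifs with hjk
  · simpa [coord_apply, hjk] using h
  · simpa [coord_apply, hjk] using h

@[simp]
theorem adjoint_L_apply (k : Fin d) (x : Fock d) (α : FreeMonoid (Fin d)) :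
    adjoint (L k) x α = x (FreeMonoid.of k * α) := by
  rw [← inner_e_left, ContinuousLinearMap.adjoint_inner_right, L_e, inner_e_left]

theorem fock_ext {x y : Fock d} (h1 : x 1 = y 1)
    (h : ∀ k α, x (FreeMonoid.of k * α) = y (FreeMonoid.of k * α)) : x = y := by
  ext α
  induction α using FreeMonoid.casesOn with
  | one => exact h1
  | of_mul k α => exact h k α

theorem adjoint_L_L (k j : Fin d) (x : Fock d) :
    adjoint (L k) (L j x) = if k = j then x else 0 := by
  ext α
  rw [adjoint_L_apply, L_apply_of_mul]
  split_ifs <;> simp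

theorem inner_L_L_of_ne {k j : Fin d} (h : k ≠ j) (x y : Fock d) :
    inner ℂ (L k x) (L j y) = 0 := by
  rw [← ContinuousLinearMap.adjoint_inner_right, adjoint_L_L, if_neg h, inner_zero_right]

/-- Every vector is the sum of its vacuum component and its components in the ranges `L_k F²`. -/
theorem eq_vac_add_sum_L (x : Fock d) : x = x 1 • e 1 + ∑ k, L k (adjoint (L k) x) := by
  apply fock_ext
  · simp only [← coord_apply 1, map_add, map_sum, map_smul]
    simp [coord_apply, e_apply]
  · intro j α
    simp only [← coord_apply (FreeMonoid.of j * α), map_add, map_sum, map_smul]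
    simp [coord_apply, e_apply, L_apply_of_mul, (one_ne_of_mul _ _).symm]

theorem eq_sum_L {x : Fock d} (h : x 1 = 0) : x = ∑ k, L k (adjoint (L k) x) := by
  conv_lhs => rw [eq_vac_add_sum_L x, h, zero_smul, zero_add]

theorem mem_ranL {x : Fock d} : x ∈ ranL d ↔ x 1 = 0 := by
  constructor
  · intro hx
    have : ranL d ≤ (coord 1 : Fock d →L[ℂ] ℂ).ker := iSup_le fun k => by
      rintro _ ⟨y, rfl⟩
      simp [coord_apply]
    simpa [coord_apply] using this hx
  · intro h
    rw [eq_sum_L h]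
    exact Submodule.sum_mem _ fun k _ =>
      Submodule.mem_iSup_of_mem k ⟨_, rfl⟩

/-! ### The graph -/

theorem inner_L2_L2 (k : Fin d) (g h : Fock2 d) : inner ℂ (L2 k g) (L2 k h) = inner ℂ g h := by
  simp [L2, WithLp.prod_inner_apply, inner_L_L]

theorem inner_L2_L2_of_ne {k j : Fin d} (hkj : k ≠ j) (g h : Fock2 d) :
    inner ℂ (L2 k g) (L2 j h) = 0 := by
  simp [L2, WithLp.prod_inner_apply, inner_L_L_of_ne hkj]

@[simp] theorem L2_fst (k : Fin d) (h : Fock2 d) : (L2 k h).fst = L k h.fst := rfl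
@[simp] theorem L2_snd (k : Fin d) (h : Fock2 d) : (L2 k h).snd = L k h.snd := rfl

/-- The operator `L_k^* ⊗ I_2`. -/
def L2star (k : Fin d) : Fock2 d →L[ℂ] Fock2 d :=
  ((WithLp.prodContinuousLinearEquiv 2 ℂ (Fock d) (Fock d)).symm : _ →L[ℂ] Fock2 d) ∘L
    ((adjoint (L k)).prodMap (adjoint (L k))) ∘L
      ((WithLp.prodContinuousLinearEquiv 2 ℂ (Fock d) (Fock d)) : Fock2 d →L[ℂ] _)

@[simp] theorem L2star_fst (k : Fin d) (h : Fock2 d) :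
    (L2star k h).fst = adjoint (L k) h.fst := rfl
@[simp] theorem L2star_snd (k : Fin d) (h : Fock2 d) :
    (L2star k h).snd = adjoint (L k) h.snd := rfl

theorem fock2_ext {g h : Fock2 d} (h1 : g.fst = h.fst) (h2 : g.snd = h.snd) : g = h := by
  apply (WithLp.linearEquiv 2 ℂ (Fock d × Fock d)).injective
  exact Prod.ext h1 h2

theorem L2star_L2 (k j : Fin d) (h : Fock2 d) :
    L2star k (L2 j h) = if k = j then h else 0 := by
  apply fock2_ext
  · rw [L2star_fst, L2_fst, adjoint_L_L]; split_ifs <;> rfl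
  · rw [L2star_snd, L2_snd, adjoint_L_L]; split_ifs <;> rfl

theorem eq_sum_L2 {h : Fock2 d} (h1 : h.fst 1 = 0) (h2 : h.snd 1 = 0) :
    h = ∑ k, L2 k (L2star k h) := by
  apply fock2_ext
  · have : (∑ k, L2 k (L2star k h)).fst = ∑ k, (L2 k (L2star k h)).fst :=
      map_sum (WithLp.fstL 2 ℂ (Fock d) (Fock d)) _ _
    rw [this]
    exact eq_sum_L h1
  · have : (∑ k, L2 k (L2star k h)).snd = ∑ k, (L2 k (L2star k h)).snd :=
      map_sum (WithLp.sndL 2 ℂ (Fock d) (Fock d)) _ _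
    rw [this]
    exact eq_sum_L h2

variable {T : Fock d →ₗ.[ℂ] Fock d}

theorem mem_G {h : Fock2 d} : h ∈ G T ↔ ∃ hx : h.fst ∈ T.domain, T ⟨h.fst, hx⟩ = h.snd := by
  change (h.fst, h.snd) ∈ T.graph ↔ _
  rw [LinearPMap.mem_graph_iff]
  constructor
  · rintro ⟨y, hy, hy'⟩
    simp only at hy hy'
    have : h.fst ∈ T.domain := hy ▸ y.2
    refine ⟨this, ?_⟩
    rw [← hy']
    congr 1
    exact Subtype.ext hy.symm
  · rintro ⟨hx, h⟩
    exact ⟨⟨_, hx⟩, rfl, h⟩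

theorem graph_mem_G (x : T.domain) : WithLp.toLp 2 ((x : Fock d), T x) ∈ G T :=
  mem_G.2 ⟨x.2, rfl⟩

theorem eq_zero_of_mem_G {h : Fock2 d} (hh : h ∈ G T) (h0 : h.fst = 0) : h = 0 := by
  obtain ⟨hx, hT⟩ := mem_G.1 hh
  refine fock2_ext h0 ?_
  rw [← hT]
  have : (⟨h.fst, hx⟩ : T.domain) = 0 := Subtype.ext h0
  rw [this, T.map_zero]
  rfl

theorem IsAffiliated.L2_mem_G (hT : IsAffiliated T) (k : Fin d) {h : Fock2 d} (hh : h ∈ G T) :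
    L2 k h ∈ G T := by
  obtain ⟨hx, hh⟩ := mem_G.1 hh
  obtain ⟨h1, h2⟩ := hT k ⟨_, hx⟩
  exact mem_G.2 ⟨h1, h2.trans (congrArg (L k) hh)⟩

/-- The subspace `(L ⊗ I_2)(G(T) ⊗ ℂ^d)`. -/
def shiftedG (T : Fock d →ₗ.[ℂ] Fock d) : Submodule ℂ (Fock2 d) :=
  ⨆ k : Fin d, (G T).map (L2 k).toLinearMap

theorem wanderingSpace_eq : wanderingSpace T = G T ⊓ (shiftedG T)ᗮ := rfl

theorem L2_mem_shiftedG (k : Fin d) {h : Fock2 d} (hh : h ∈ G T) : L2 k h ∈ shiftedG T :=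
  Submodule.mem_iSup_of_mem k ⟨h, hh, rfl⟩

/-- The relations L_j^*L_k = δ_jk let L_k^* ⊕ L_k^* recover the summands of a shifted vector.
Membership thus becomes a family of closed conditions, which gives closedness of the shifted space
without passing to a closure. -/
theorem mem_shiftedG {h : Fock2 d} :
    h ∈ shiftedG T ↔ h.fst 1 = 0 ∧ h.snd 1 = 0 ∧ ∀ k, L2star k h ∈ G T := by
  constructor
  · intro hh
    let f1 : Fock2 d →L[ℂ] ℂ := coord 1 ∘L WithLp.fstL 2 ℂ (Fock d) (Fock d)
    let f2 : Fock2 d →L[ℂ] ℂ := coord 1 ∘L WithLp.sndL 2 ℂ (Fock d) (Fock d)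
    have h1 : shiftedG T ≤ f1.ker := iSup_le fun k => by
      rintro _ ⟨y, -, rfl⟩
      simp [f1, coord_apply]
    have h2 : shiftedG T ≤ f2.ker := iSup_le fun k => by
      rintro _ ⟨y, -, rfl⟩
      simp [f2, coord_apply]
    have h3 (j : Fin d) : shiftedG T ≤ (G T).comap (L2star j).toLinearMap := iSup_le fun k => by
      rintro _ ⟨y, hy, rfl⟩
      simp only [ContinuousLinearMap.coe_coe, Submodule.mem_comap, L2star_L2]
      split_ifs
      exacts [hy, zero_mem _]
    refine ⟨?_, ?_, fun k => h3 k hh⟩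
    · simpa [f1, coord_apply] using h1 hh
    · simpa [f2, coord_apply] using h2 hh
  · rintro ⟨h1, h2, h3⟩
    rw [eq_sum_L2 h1 h2]
    exact Submodule.sum_mem _ fun k _ => L2_mem_shiftedG k (h3 k)

theorem isClosed_shiftedG (hT : T.IsClosed) : IsClosed (shiftedG T : Set (Fock2 d)) := by
  have : (shiftedG T : Set (Fock2 d)) =
      {h | coord 1 (WithLp.fstL 2 ℂ (Fock d) (Fock d) h) = 0} ∩
      ({h | coord 1 (WithLp.sndL 2 ℂ (Fock d) (Fock d) h) = 0} ∩
        ⋂ k, (L2star k) ⁻¹' (G T : Set (Fock2 d))) := by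
    ext h
    simp [mem_shiftedG, coord_apply]
  rw [this]
  refine (isClosed_eq ?_ continuous_const).inter ((isClosed_eq ?_ continuous_const).inter
    (isClosed_iInter fun k => (isClosed_G hT).preimage (L2star k).continuous))
  · exact (coord 1).continuous.comp (WithLp.fstL 2 ℂ (Fock d) (Fock d)).continuous
  · exact (coord 1).continuous.comp (WithLp.sndL 2 ℂ (Fock d) (Fock d)).continuous

theorem IsAffiliated.shiftedG_le (hT : IsAffiliated T) : shiftedG T ≤ G T :=
  iSup_le fun k => by
    rintro _ ⟨y, hy, rfl⟩
    exact hT.L2_mem_G k hy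

/-! ### The wandering space and locality -/

/-- `X* 1` as a vector of `F² ⊕ F²`. -/
def xvac (hT : T.IsClosed) : Fock2 d := Xstar T hT (vac d)

theorem xvac_mem_G (hT : T.IsClosed) : xvac hT ∈ G T := (Xstar T hT (vac d)).2

theorem inner_xvac (hT : T.IsClosed) {h : Fock2 d} (hh : h ∈ G T) :
    inner ℂ (xvac hT) h = h.fst 1 := by
  have : CompleteSpace (G T) := (isClosed_G hT).completeSpace_coe
  have h1 : inner ℂ (xvac hT) h = inner ℂ (adjoint (X T) (vac d)) (⟨h, hh⟩ : G T) := rfl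
  rw [h1, ContinuousLinearMap.adjoint_inner_left]
  exact inner_e_left 1 h.fst

theorem xvac_mem_wanderingSpace (hT : LesssimR T) : xvac hT.closed ∈ wanderingSpace T := by
  refine ⟨xvac_mem_G _, ?_⟩
  refine (Submodule.mem_orthogonal' _ _).2 fun h hh => ?_
  rw [inner_xvac _ (hT.affiliated.shiftedG_le hh)]
  exact (mem_shiftedG.1 hh).1

/-- If X*1 = 0, every x in dom T has x_∅ = 0, so the vacuum is orthogonal to dom T. -/
theorem LesssimR.xvac_ne_zero (hT : LesssimR T) : xvac hT.closed ≠ 0 := by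
  intro h0
  apply hT.vac_notMem
  rw [Submodule.mem_orthogonal']
  intro x hx
  have := inner_xvac hT.closed (graph_mem_G ⟨x, hx⟩)
  rw [h0, inner_zero_left] at this
  rw [vac, inner_e_left]
  exact this.symm

/-- By the reproducing property, the right side says that no nonzero wandering vector is orthogonal
to X*1. -/
theorem xstarVacSpans_iff (hT : LesssimR T) :
    XstarVacSpans T hT.closed ↔ ∀ h ∈ wanderingSpace T, h.fst 1 = 0 → h = 0 := by
  change Submodule.span ℂ {xvac hT.closed} = _ ↔ _
  constructor
  · intro hs h hh h0
    rw [← inner_xvac hT.closed hh.1] at h0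
    rw [← hs] at hh
    obtain ⟨c, rfl⟩ := Submodule.mem_span_singleton.1 hh
    rw [inner_smul_right, mul_eq_zero, inner_self_eq_zero] at h0
    rcases h0 with h0 | h0 <;> simp [h0]
  · intro H
    refine le_antisymm ?_ fun h hh => ?_
    · rw [Submodule.span_singleton_le_iff_mem]
      exact xvac_mem_wanderingSpace hT
    · have hx := xvac_mem_wanderingSpace hT
      have hne : inner ℂ (xvac hT.closed) (xvac hT.closed) ≠ 0 :=
        inner_self_ne_zero.2 hT.xvac_ne_zero
      let c : ℂ := inner ℂ (xvac hT.closed) h / inner ℂ (xvac hT.closed) (xvac hT.closed)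
      have hmem : h - c • xvac hT.closed ∈ wanderingSpace T :=
        sub_mem hh (Submodule.smul_mem _ _ hx)
      have := H _ hmem (by
        rw [← inner_xvac hT.closed hmem.1, inner_sub_right, inner_smul_right,
          div_mul_cancel₀ _ hne, sub_self])
      rw [sub_eq_zero] at this
      exact Submodule.mem_span_singleton.2 ⟨c, this.symm⟩

/-- Split the vector into a shifted and a wandering part. The shifted part has no vacuum
coefficient, so neither has the wandering part, which therefore vanishes. -/
theorem XstarVacSpans.mem_shiftedG (hT : LesssimR T) (hs : XstarVacSpans T hT.closed)
    {h : Fock2 d} (hh : h ∈ G T) (h0 : h.fst 1 = 0) : h ∈ shiftedG T := by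
  have : CompleteSpace (shiftedG T) := (isClosed_shiftedG hT.closed).completeSpace_coe
  have := Submodule.sup_orthogonal_inf_of_hasOrthogonalProjection hT.affiliated.shiftedG_le
  rw [← this] at hh
  obtain ⟨s, hs', w, hw, rfl⟩ := Submodule.mem_sup.1 hh
  have hw0 : w = 0 := by
    refine (xstarVacSpans_iff hT).1 hs w (wanderingSpace_eq ▸ ⟨hw.2, hw.1⟩) ?_
    have h1 := (FreeSmirnov.mem_shiftedG.1 hs').1
    have h2 : (s + w).fst 1 = s.fst 1 + w.fst 1 := rfl
    rw [h2, h1, zero_add] at h0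
    exact h0
  rw [hw0, add_zero]
  exact hs'

theorem isLocal_iff_xstarVacSpans (hT : LesssimR T) :
    IsLocal T ↔ XstarVacSpans T hT.closed := by
  constructor
  · intro hl
    rw [xstarVacSpans_iff hT]
    intro h hh h0
    obtain ⟨hx, hTx⟩ := mem_G.1 hh.1
    have hk (k : Fin d) : adjoint (L k) h.fst ∈ T.domain := hl _ hx (mem_ranL.2 h0) k
    let g (k : Fin d) : Fock2 d := WithLp.toLp 2 (adjoint (L k) h.fst, T ⟨_, hk k⟩)
    have hg (k : Fin d) : g k ∈ G T := graph_mem_G ⟨_, hk k⟩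
    have hs : ∑ k, L2 k (g k) ∈ shiftedG T :=
      Submodule.sum_mem _ fun k _ => L2_mem_shiftedG k (hg k)
    -- Both are graph vectors over the same x = Σ L_k L_k^*x. So h is shifted as well as wandering,
    -- hence orthogonal to itself.
    have heq : h - ∑ k, L2 k (g k) = 0 := by
      apply eq_zero_of_mem_G (sub_mem hh.1 (hT.affiliated.shiftedG_le hs))
      have h1 : (h - ∑ k, L2 k (g k)).fst = h.fst - ∑ k, (L2 k (g k)).fst := by
        have := map_sub (WithLp.fstL 2 ℂ (Fock d) (Fock d)) h (∑ k, L2 k (g k))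
        rw [map_sum] at this
        exact this
      rw [h1]
      exact sub_eq_zero.2 (eq_sum_L h0)
    rw [sub_eq_zero] at heq
    rw [← heq] at hs
    exact inner_self_eq_zero.1 ((Submodule.mem_orthogonal _ _).1 hh.2 h hs)
  · intro hs x hx hx0 k
    have hmem := hs.mem_shiftedG hT (graph_mem_G ⟨x, hx⟩) (mem_ranL.1 hx0)
    exact (mem_G.1 ((mem_shiftedG.1 hmem).2.2 k)).1

/-! ### The Wold decomposition of the graph -/

theorem lift_L2_eq (α : FreeMonoid (Fin d)) (w : Fock2 d) :
    FreeMonoid.lift L2 α w =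
      WithLp.toLp 2 (FreeMonoid.lift L α w.fst, FreeMonoid.lift L α w.snd) := by
  induction α using FreeMonoid.inductionOn' with
  | one => rfl
  | of_mul k α ih =>
    simp only [map_mul, FreeMonoid.lift_eval_of, mul_apply_eq_comp, ih, L2_apply]

theorem IsAffiliated.lift_L2_mem_G (hT : IsAffiliated T) (α : FreeMonoid (Fin d)) {w : Fock2 d}
    (hw : w ∈ G T) : FreeMonoid.lift L2 α w ∈ G T := by
  induction α using FreeMonoid.inductionOn' with
  | one => exact hw
  | of_mul k α ih =>
    rw [map_mul, FreeMonoid.lift_eval_of, mul_apply_eq_comp]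
    exact hT.L2_mem_G k ih

/-- Cancel common first letters. Either the words are equal, or different first letters give
orthogonal ranges, or one word runs out and w is paired with a shifted graph vector. -/
theorem IsAffiliated.orthonormal_lift_L2 (hT : IsAffiliated T) {w : Fock2 d}
    (hw : w ∈ wanderingSpace T) (h1 : inner ℂ w w = 1) :
    Orthonormal ℂ fun α : FreeMonoid (Fin d) => FreeMonoid.lift L2 α w := by
  have key (k : Fin d) (α : FreeMonoid (Fin d)) :
      inner ℂ w (FreeMonoid.lift L2 (FreeMonoid.of k * α) w) = 0 := by
    rw [map_mul, FreeMonoid.lift_eval_of, mul_apply_eq_comp]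
    exact (Submodule.mem_orthogonal' _ _).1 hw.2 _
      (L2_mem_shiftedG k (hT.lift_L2_mem_G α hw.1))
  rw [orthonormal_iff_ite]
  intro α
  induction α using FreeMonoid.inductionOn' with
  | one =>
    intro β
    induction β using FreeMonoid.casesOn with
    | one => simpa using h1
    | of_mul k β => rw [if_neg (one_ne_of_mul k β)]; exact key k β
  | of_mul j α ih =>
    intro β
    induction β using FreeMonoid.casesOn with
    | one =>
      rw [if_neg (one_ne_of_mul j α).symm, ← inner_conj_symm, map_one]
      simpa using congrArg (starRingEnd ℂ) (key j α)
    | of_mul k β =>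
      simp only [map_mul, FreeMonoid.lift_eval_of, mul_apply_eq_comp, of_mul_inj]
      by_cases hjk : j = k
      · subst hjk
        rw [inner_L2_L2, ih]
        simp
      · simp [hjk, inner_L2_L2_of_ne hjk]

/-- If `X* 1` spans the wandering space, no nonzero vector of the graph is orthogonal to all
translates of `X* 1`. -/
theorem XstarVacSpans.eq_zero_of_orthogonal (hT : LesssimR T) (hs : XstarVacSpans T hT.closed)
    {h : Fock2 d} (hh : h ∈ G T)
    (horth : ∀ α, inner ℂ (FreeMonoid.lift L2 α (xvac hT.closed)) h = 0) : h = 0 := by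
  -- The induction on β must range over all h: its step replaces h by (L_k^* ⊕ L_k^*)h, which is
  -- again in the graph and orthogonal to all translates.
  have main (β : FreeMonoid (Fin d)) : ∀ h ∈ G T,
      (∀ α, inner ℂ (FreeMonoid.lift L2 α (xvac hT.closed)) h = 0) →
        h.fst β = 0 ∧ h.snd β = 0 := by
    have step : ∀ h ∈ G T, (∀ α, inner ℂ (FreeMonoid.lift L2 α (xvac hT.closed)) h = 0) →
        h ∈ shiftedG T := fun h hh horth => hs.mem_shiftedG hT hh (by
      rw [← inner_xvac hT.closed hh]
      exact horth 1)
    induction β using FreeMonoid.inductionOn' with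
    | one =>
      intro h hh horth
      have := FreeSmirnov.mem_shiftedG.1 (step h hh horth)
      exact ⟨this.1, this.2.1⟩
    | of_mul k β ih =>
      intro h hh horth
      obtain ⟨h1, h2, h3⟩ := FreeSmirnov.mem_shiftedG.1 (step h hh horth)
      have := ih (L2star k h) (h3 k) fun α => by
        have hα := horth (FreeMonoid.of k * α)
        rw [map_mul, FreeMonoid.lift_eval_of, mul_apply_eq_comp,
          eq_sum_L2 h1 h2, inner_sum, Finset.sum_eq_single k] at hα
        · rwa [inner_L2_L2] at hα
        · intro j _ hj
          exact inner_L2_L2_of_ne hj.symm _ _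
        · simp
      simpa using this
  refine fock2_ext ?_ ?_
  · ext β
    exact (main β h hh horth).1
  · ext β
    exact (main β h hh horth).2

/-- If `X* 1` spans the wandering space, the graph is parametrized by a pair of bounded right
multiplications. -/
theorem XstarVacSpans.exists_parametrization (hT : LesssimR T) (hs : XstarVacSpans T hT.closed) :
    ∃ (a b : Fock d) (MA MB : Fock d →L[ℂ] Fock d),
      (∀ α, MA (e α) = FreeMonoid.lift L α a) ∧ (∀ α, MB (e α) = FreeMonoid.lift L α b) ∧
      ∀ h : Fock2 d, h ∈ G T ↔ ∃ u, h.fst = MA u ∧ h.snd = MB u := by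
  set v := xvac hT.closed with hv
  have hne : (‖v‖ : ℂ) ≠ 0 := by simpa using hT.xvac_ne_zero
  set w : Fock2 d := (‖v‖ : ℂ)⁻¹ • v with hw
  have hwW : w ∈ wanderingSpace T := Submodule.smul_mem _ _ (xvac_mem_wanderingSpace hT)
  have hw1 : inner ℂ w w = 1 := by
    rw [inner_self_eq_norm_sq_to_K, hw, norm_smul]
    have : ‖v‖ ≠ 0 := by exact_mod_cast hne
    simp [this]
  have ho := hT.affiliated.orthonormal_lift_L2 hwW hw1
  let Θ := ho.orthogonalFamily.linearIsometry
  have hΘe (α) : Θ (e α) = FreeMonoid.lift L2 α w := by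
    change ho.orthogonalFamily.linearIsometry (lp.single 2 α (1 : ℂ)) = _
    rw [OrthogonalFamily.linearIsometry_apply_single]
    simp
  have hΘG (u) : Θ u ∈ G T := by
    have hsum := (Θ.toContinuousLinearMap).hasSum (hasSum_smul_e u)
    refine (isClosed_G hT.closed).mem_of_tendsto hsum (Filter.Eventually.of_forall fun s => ?_)
    refine Submodule.sum_mem _ fun α _ => ?_
    simp only [map_smul]
    refine Submodule.smul_mem _ _ ?_
    change Θ (e α) ∈ _
    rw [hΘe]
    exact hT.affiliated.lift_L2_mem_G α hwW.1
  let R := LinearMap.range Θ.toLinearMap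
  have hRG : R ≤ G T := by
    rintro _ ⟨u, rfl⟩
    exact hΘG u
  -- Completeness of the range of Θ gives an orthogonal splitting of the graph; the complement is
  -- orthogonal to all translates of X*1 and so is zero.
  have : CompleteSpace R :=
    (Θ.isometry.isUniformInducing.isComplete_range).completeSpace_coe
  have hGR : G T ≤ R := by
    intro h hh
    rw [← Submodule.sup_orthogonal_inf_of_hasOrthogonalProjection hRG] at hh
    obtain ⟨r, hr, q, hq, rfl⟩ := Submodule.mem_sup.1 hh
    have : q = 0 := by
      refine hs.eq_zero_of_orthogonal hT hq.2 fun α => ?_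
      have h1 := (Submodule.mem_orthogonal _ _).1 hq.1 (Θ (e α)) ⟨_, rfl⟩
      rw [hΘe, hw, map_smul, inner_smul_left, mul_eq_zero] at h1
      rcases h1 with h1 | h1
      · simp at h1
        exact absurd h1 hT.xvac_ne_zero
      · exact h1
    rw [this, add_zero]
    exact hr
  refine ⟨w.fst, w.snd, WithLp.fstL 2 ℂ (Fock d) (Fock d) ∘L Θ.toContinuousLinearMap,
    WithLp.sndL 2 ℂ (Fock d) (Fock d) ∘L Θ.toContinuousLinearMap, fun α => ?_, fun α => ?_,
    fun h => ⟨fun hh => ?_, ?_⟩⟩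
  · change (Θ (e α)).fst = _
    rw [hΘe, lift_L2_eq]
    rfl
  · change (Θ (e α)).snd = _
    rw [hΘe, lift_L2_eq]
    rfl
  · obtain ⟨u, rfl⟩ := hGR hh
    exact ⟨u, rfl, rfl⟩
  · rintro ⟨u, h1, h2⟩
    have : h = Θ u := fock2_ext h1 h2
    rw [this]
    exact hΘG u

/-! ### The non-commutative unit ball -/

section Ball

open scoped Matrix.Norms.L2Operator Kronecker

/-- The row `(Z_1, …, Z_d)` as a rectangular matrix. -/
def rowMat {n m : ℕ} (Z : Fin d → Matrix (Fin n) (Fin m) ℂ) :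
    Matrix (Fin n) (Fin d × Fin m) ℂ :=
  Matrix.of fun i p => Z p.1 i p.2

theorem mem_ball {n : ℕ} {Z : Fin d → Matrix (Fin n) (Fin n) ℂ} :
    Z ∈ ball d n ↔ ‖rowMat Z‖ < 1 := Iff.rfl

theorem zero_mem_ball (d n : ℕ) : (0 : Fin d → Matrix (Fin n) (Fin n) ℂ) ∈ ball d n := by
  rw [mem_ball]
  have : rowMat (0 : Fin d → Matrix (Fin n) (Fin n) ℂ) = 0 := rfl
  simp [this]

/-- A strict row contraction contracts row vectors by a uniform factor. -/
theorem exists_sum_vecMul_le {n : ℕ} {Z : Fin d → Matrix (Fin n) (Fin n) ℂ} (hZ : Z ∈ ball d n) :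
    ∃ r : ℝ, r < 1 ∧ ∀ u : Fin n → ℂ,
      ∑ k, ∑ j, ‖Matrix.vecMul u (Z k) j‖ ^ 2 ≤ r * ∑ j, ‖u j‖ ^ 2 := by
  refine ⟨‖rowMat Z‖ ^ 2, pow_lt_one₀ (norm_nonneg _) (mem_ball.1 hZ) two_ne_zero,
    fun u => ?_⟩
  have h := Matrix.l2_opNorm_mulVec (rowMat Z).conjTranspose (WithLp.toLp 2 (star u))
  rw [Matrix.l2_opNorm_conjTranspose] at h
  have h2 := pow_le_pow_left₀ (norm_nonneg _) h 2
  rw [mul_pow, EuclideanSpace.norm_sq_eq, EuclideanSpace.norm_sq_eq] at h2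
  change ∑ p, ‖Matrix.mulVec (rowMat Z).conjTranspose (star u) p‖ ^ 2 ≤ _ at h2
  have h3 : ∀ p : Fin d × Fin n,
      ‖Matrix.mulVec (rowMat Z).conjTranspose (star u) p‖ = ‖Matrix.vecMul u (Z p.1) p.2‖ := by
    intro p
    rw [← Matrix.star_vecMul, Pi.star_apply, norm_star]
    rfl
  simp only [h3, Fintype.sum_prod_type, Pi.star_apply, norm_star] at h2
  exact h2

theorem rowMat_mul_mul {n m n' m' : ℕ} (A : Matrix (Fin n') (Fin n) ℂ)
    (Z : Fin d → Matrix (Fin n) (Fin m) ℂ) (P : Matrix (Fin m) (Fin m') ℂ) :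
    rowMat (fun k => A * Z k * P) = A * rowMat Z * ((1 : Matrix (Fin d) (Fin d) ℂ) ⊗ₖ P) := by
  ext i ⟨k, j⟩
  simp only [rowMat, Matrix.of_apply, Matrix.mul_apply, Fintype.sum_prod_type,
    Matrix.kroneckerMap_apply, Matrix.one_apply]
  rw [Finset.sum_eq_single k]
  · simp
  · intro l _ hl
    simp [hl]
  · simp

theorem norm_le_one_of_mul_conjTranspose {m n : Type*} [Fintype m] [Fintype n] [DecidableEq m]
    [DecidableEq n] {P : Matrix m n ℂ} (h : P * P.conjTranspose = 1) : ‖P‖ ≤ 1 := by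
  have h1 := Matrix.l2_opNorm_conjTranspose_mul_self P.conjTranspose
  rw [Matrix.conjTranspose_conjTranspose, h, Matrix.l2_opNorm_conjTranspose,
    ← Matrix.diagonal_one, Matrix.l2_opNorm_diagonal] at h1
  -- Only an inequality, since `m` may be empty.
  have h2 : ‖fun _ : m => (1 : ℂ)‖ ≤ 1 := (pi_norm_le_iff_of_nonneg zero_le_one).2 (by simp)
  rw [h1] at h2
  nlinarith [norm_nonneg P]

/-- Conjugating by the coisometry P does not increase the row norm, and the slack 1 − ‖Z‖ absorbs a
small multiple of E. -/
theorem exists_block_mem_ball {n N : ℕ} {Z : Fin d → Matrix (Fin n) (Fin n) ℂ}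
    (hZ : Z ∈ ball d n) {P : Matrix (Fin n) (Fin N) ℂ} (hP : P * P.conjTranspose = 1)
    (E : Fin d → Matrix (Fin N) (Fin N) ℂ) :
    ∃ c : ℂ, c ≠ 0 ∧ (fun k => P.conjTranspose * Z k * P + c • E k) ∈ ball d N := by
  obtain ⟨c, hc, hlt⟩ := exists_pos_mul_lt (sub_pos.2 (mem_ball.1 hZ)) ‖rowMat E‖
  refine ⟨c, by exact_mod_cast hc.ne', mem_ball.2 ?_⟩
  have h1 : rowMat (fun k => P.conjTranspose * Z k * P + (c : ℂ) • E k) =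
      rowMat (fun k => P.conjTranspose * Z k * P) + (c : ℂ) • rowMat E := rfl
  have hK : ((1 : Matrix (Fin d) (Fin d) ℂ) ⊗ₖ P) *
      ((1 : Matrix (Fin d) (Fin d) ℂ) ⊗ₖ P).conjTranspose = 1 := by
    rw [Matrix.conjTranspose_kronecker, ← Matrix.mul_kronecker_mul, hP]
    simp
  have h2 : ‖rowMat (fun k => P.conjTranspose * Z k * P)‖ ≤ ‖rowMat Z‖ := by
    rw [rowMat_mul_mul]
    calc _ ≤ ‖P.conjTranspose‖ * ‖rowMat Z‖ * ‖(1 : Matrix (Fin d) (Fin d) ℂ) ⊗ₖ P‖ :=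
          (Matrix.l2_opNorm_mul _ _).trans (by gcongr; exact Matrix.l2_opNorm_mul _ _)
      _ ≤ 1 * ‖rowMat Z‖ * 1 := by
          gcongr
          · rw [Matrix.l2_opNorm_conjTranspose]
            exact norm_le_one_of_mul_conjTranspose hP
          · exact norm_le_one_of_mul_conjTranspose hK
      _ = _ := by ring
  rw [h1]
  calc _ ≤ ‖rowMat (fun k => P.conjTranspose * Z k * P)‖ + ‖(c : ℂ) • rowMat E‖ := norm_add_le _ _
    _ ≤ ‖rowMat Z‖ + ‖rowMat E‖ * c := by
      gcongr
      rw [norm_smul, Complex.norm_of_nonneg hc.le, mul_comm]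
    _ < 1 := by linarith

end Ball

/-- Free functions on the ball can be cancelled from the row `(Z_1, …, Z_d)`. -/
theorem eq_zero_of_sum_mul_eq_zero {g : Fin d → NCMap d} (hg : ∀ k, IsFree (g k))
    (h : ∀ n, ∀ Z ∈ ball d n, ∑ k, Z k * g k n Z = 0) (j : Fin d) (n : ℕ)
    {Z : Fin d → Matrix (Fin n) (Fin n) ℂ} (hZ : Z ∈ ball d n) : g j n Z = 0 := by
  let P : Matrix (Fin n) (Fin (n + n)) ℂ := Matrix.of fun i => Pi.single (Fin.natAdd n i) 1
  let Q : Matrix (Fin n) (Fin (n + n)) ℂ := Matrix.of fun i => Pi.single (Fin.castAdd n i) 1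
  have hPP : P * P.conjTranspose = 1 := by
    ext i k
    simp [P, Matrix.mul_apply, Pi.single_apply, Matrix.one_apply, eq_comm]
  have hQQ : Q * Q.conjTranspose = 1 := by
    ext i k
    simp [Q, Matrix.mul_apply, Pi.single_apply, Matrix.one_apply, eq_comm]
  have hPQ : P * Q.conjTranspose = 0 := by
    ext i k
    simp only [P, Q, Matrix.mul_apply, Matrix.of_apply, Matrix.conjTranspose_apply,
      Pi.single_apply, Matrix.zero_apply]
    refine Finset.sum_eq_zero fun x _ => ?_
    split_ifs with h1 h2
    · have := congrArg Fin.val (h1.symm.trans h2)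
      simp at this
      lia
    all_goals simp
  have hQP : Q * P.conjTranspose = 0 := by
    simpa using congrArg Matrix.conjTranspose hPQ
  -- In blocks, W_k = [[0, c δ_kj], [0, Z_k]]: P intertwines Z with W, while Q detects only the j-th
  -- entry.
  obtain ⟨c, hc, hW⟩ := exists_block_mem_ball hZ hPP
    (fun k => if k = j then Q.conjTranspose * P else 0)
  set W : Fin d → Matrix (Fin (n + n)) (Fin (n + n)) ℂ :=
    fun k => P.conjTranspose * Z k * P + c • (if k = j then Q.conjTranspose * P else 0) with hWdef
  have hPW (k) : Z k * P = P * W k := by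
    simp only [hWdef, Matrix.mul_add, Matrix.mul_smul, ← Matrix.mul_assoc, hPP, Matrix.one_mul]
    split_ifs
    · simp [← Matrix.mul_assoc, hPQ]
    · simp
  have hQW (k) : Q * W k = if k = j then c • P else 0 := by
    simp only [hWdef, Matrix.mul_add, Matrix.mul_smul, ← Matrix.mul_assoc, hQP, Matrix.zero_mul]
    split_ifs
    · simp [← Matrix.mul_assoc, hQQ]
    · simp
  -- Multiplying by Q on the left isolates c P g_j(W), which equals c g_j(Z) P because g_j is free.
  have hsum := congrArg (Q * ·) (h _ W hW)
  simp only [Matrix.mul_sum, ← Matrix.mul_assoc, hQW, Matrix.mul_zero] at hsum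
  rw [Finset.sum_eq_single j (by intro k _ hk; simp [hk]) (by simp), if_pos rfl,
    Matrix.smul_mul, ← hg j n (n + n) Z hZ W hW P hPW, smul_eq_zero, or_iff_right hc] at hsum
  calc g j n Z = g j n Z * P * P.conjTranspose := by rw [Matrix.mul_assoc, hPP, Matrix.mul_one]
    _ = 0 := by rw [hsum, Matrix.zero_mul]

/-! ### Evaluation on the ball -/

/-- The words of length less than `m`. -/
def wordsLT (d : ℕ) : ℕ → Finset (FreeMonoid (Fin d))
  | 0 => ∅
  | m + 1 => insert 1 ((Finset.univ ×ˢ wordsLT d m).image fun p => FreeMonoid.of p.1 * p.2)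

theorem mem_wordsLT {m : ℕ} {α : FreeMonoid (Fin d)} (h : α.length < m) : α ∈ wordsLT d m := by
  induction m generalizing α with
  | zero => simp at h
  | succ m ih =>
    induction α using FreeMonoid.casesOn with
    | one => simp [wordsLT]
    | of_mul k α =>
      simp only [FreeMonoid.length_mul, FreeMonoid.length_of] at h
      simp only [wordsLT, Finset.mem_insert, Finset.mem_image, Finset.mem_product,
        Finset.mem_univ, true_and]
      exact .inr ⟨(k, α), ih (by lia), rfl⟩

theorem sum_wordsLT_succ (f : FreeMonoid (Fin d) → ℝ) (m : ℕ) :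
    ∑ α ∈ wordsLT d (m + 1), f α =
      f 1 + ∑ k, ∑ α ∈ wordsLT d m, f (FreeMonoid.of k * α) := by
  rw [wordsLT, Finset.sum_insert, Finset.sum_image, Finset.sum_product]
  · rintro ⟨j, α⟩ - ⟨k, β⟩ - h
    obtain ⟨h1, h2⟩ := (of_mul_inj j k α β).1 h
    exact Prod.ext h1 h2
  · simp [(one_ne_of_mul _ _).symm]

/-- Splitting off the first letter turns a bound C into 1 + rC, whose fixed point is (1 − r)⁻¹. The
vector u varies in the induction, since a first letter k replaces it by u Z_k. -/
theorem sum_wordsLT_vecMul_le {n : ℕ} {Z : Fin d → Matrix (Fin n) (Fin n) ℂ} {r : ℝ}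
    (h1 : r < 1)
    (hr : ∀ u : Fin n → ℂ, ∑ k, ∑ j, ‖Matrix.vecMul u (Z k) j‖ ^ 2 ≤ r * ∑ j, ‖u j‖ ^ 2)
    (m : ℕ) (u : Fin n → ℂ) :
    ∑ α ∈ wordsLT d m, ∑ j, ‖Matrix.vecMul u (FreeMonoid.lift Z α) j‖ ^ 2 ≤
      (1 - r)⁻¹ * ∑ j, ‖u j‖ ^ 2 := by
  have hpos : 0 < 1 - r := sub_pos.2 h1
  induction m generalizing u with
  | zero =>
    simp only [wordsLT, Finset.sum_empty]
    positivity
  | succ m ih =>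
    rw [sum_wordsLT_succ]
    simp only [map_one, Matrix.vecMul_one, map_mul, FreeMonoid.lift_eval_of,
      ← Matrix.vecMul_vecMul]
    calc _ ≤ ∑ j, ‖u j‖ ^ 2 + ∑ k, (1 - r)⁻¹ * ∑ j, ‖Matrix.vecMul u (Z k) j‖ ^ 2 := by
          gcongr with k
          exact ih _
      _ ≤ ∑ j, ‖u j‖ ^ 2 + (1 - r)⁻¹ * (r * ∑ j, ‖u j‖ ^ 2) := by
          rw [← Finset.mul_sum]
          gcongr
          exact hr u
      _ = _ := by field_simp; ring

theorem summable_norm_lift_sq {n : ℕ} {Z : Fin d → Matrix (Fin n) (Fin n) ℂ} (hZ : Z ∈ ball d n)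
    (i j : Fin n) : Summable fun α : FreeMonoid (Fin d) => ‖FreeMonoid.lift Z α i j‖ ^ 2 := by
  obtain ⟨r, h1, hr⟩ := exists_sum_vecMul_le hZ
  refine summable_of_sum_le (c := (1 - r)⁻¹ * ∑ j, ‖(Pi.single i 1 : Fin n → ℂ) j‖ ^ 2)
    (fun α => by positivity) fun s => ?_
  -- Every finite set of words has bounded length, and the bound used next does not depend on that
  -- length.
  have hs : s ⊆ wordsLT d (s.sup FreeMonoid.length + 1) := fun α hα =>
    mem_wordsLT (Nat.lt_succ_of_le (Finset.le_sup hα))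
  refine (Finset.sum_le_sum_of_subset_of_nonneg hs fun _ _ _ => by positivity).trans
    (le_trans (Finset.sum_le_sum fun α _ => ?_)
      (sum_wordsLT_vecMul_le h1 hr _ (Pi.single i 1)))
  simp only [Matrix.single_one_vecMul]
  exact Finset.single_le_sum (f := fun j => ‖FreeMonoid.lift Z α i j‖ ^ 2)
    (fun _ _ => by positivity) (Finset.mem_univ j)

/-- The vector which represents the functional `x ↦ x(Z)_{ij}`. -/
def evalVec {n : ℕ} {Z : Fin d → Matrix (Fin n) (Fin n) ℂ} (hZ : Z ∈ ball d n) (i j : Fin n) :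
    Fock d :=
  ⟨fun α => star (FreeMonoid.lift Z α i j), memℓp_gen (by
    simpa using summable_norm_lift_sq hZ i j)⟩

theorem eval_apply {n : ℕ} {Z : Fin d → Matrix (Fin n) (Fin n) ℂ} (hZ : Z ∈ ball d n)
    (x : Fock d) (i j : Fin n) : eval x n Z i j = inner ℂ (evalVec hZ i j) x := by
  have h (i j) : HasSum (fun α => (x α • FreeMonoid.lift Z α) i j)
      (inner ℂ (evalVec hZ i j) x) := by
    have := lp.hasSum_inner (𝕜 := ℂ) (evalVec hZ i j) x
    simpa [evalVec] using this
  have hs : HasSum (fun α => x α • FreeMonoid.lift Z α)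
      (Matrix.of fun i j => inner ℂ (evalVec hZ i j) x) :=
    Pi.hasSum.2 fun i => Pi.hasSum.2 fun j => h i j
  rw [eval, hs.tsum_eq]
  rfl

/-- Evaluation at a point of the ball, as a continuous linear map. -/
def evalL {n : ℕ} {Z : Fin d → Matrix (Fin n) (Fin n) ℂ} (hZ : Z ∈ ball d n) :
    Fock d →L[ℂ] Matrix (Fin n) (Fin n) ℂ where
  toFun x := eval x n Z
  map_add' x y := by
    ext i j
    simp [eval_apply hZ]
  map_smul' c x := by
    ext i j
    simp [eval_apply hZ]
  cont := continuous_matrix fun i j => by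
    simp only [eval_apply hZ]
    fun_prop

theorem evalL_apply {n : ℕ} {Z : Fin d → Matrix (Fin n) (Fin n) ℂ} (hZ : Z ∈ ball d n)
    (x : Fock d) : evalL hZ x = eval x n Z := rfl

theorem eval_e {n : ℕ} {Z : Fin d → Matrix (Fin n) (Fin n) ℂ} (α : FreeMonoid (Fin d)) :
    eval (e α) n Z = FreeMonoid.lift Z α := by
  rw [eval, tsum_eq_single α]
  · simp [e_apply]
  · intro β hβ
    simp [e_apply, hβ]

/-- Left multiplication by a matrix, as a continuous linear map. -/
def mulLeftL {l m n : ℕ} (A : Matrix (Fin l) (Fin m) ℂ) :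
    Matrix (Fin m) (Fin n) ℂ →L[ℂ] Matrix (Fin l) (Fin n) ℂ where
  toFun B := A * B
  map_add' := Matrix.mul_add A
  map_smul' c B := Matrix.mul_smul A c B
  cont := continuous_const.matrix_mul continuous_id

/-- Right multiplication by a matrix, as a continuous linear map. -/
def mulRightL {l m n : ℕ} (A : Matrix (Fin m) (Fin n) ℂ) :
    Matrix (Fin l) (Fin m) ℂ →L[ℂ] Matrix (Fin l) (Fin n) ℂ where
  toFun B := B * A
  map_add' B C := Matrix.add_mul B C A
  map_smul' c B := Matrix.smul_mul c B A
  cont := continuous_id.matrix_mul continuous_const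

theorem lift_mul_eq_mul_lift {n m : ℕ} {Z : Fin d → Matrix (Fin n) (Fin n) ℂ}
    {W : Fin d → Matrix (Fin m) (Fin m) ℂ} {S : Matrix (Fin n) (Fin m) ℂ}
    (h : ∀ k, Z k * S = S * W k) (α : FreeMonoid (Fin d)) :
    FreeMonoid.lift Z α * S = S * FreeMonoid.lift W α := by
  induction α using FreeMonoid.inductionOn' with
  | one => simp
  | of_mul k α ih =>
    simp only [map_mul, FreeMonoid.lift_eval_of]
    rw [Matrix.mul_assoc, ih, ← Matrix.mul_assoc, h, Matrix.mul_assoc]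

theorem isFree_eval (x : Fock d) : IsFree (eval x) := by
  intro n m Z hZ W hW S hS
  have : mulRightL S ∘L evalL hZ = mulLeftL S ∘L evalL hW := clm_ext_e fun α => by
    change eval (e α) n Z * S = S * eval (e α) m W
    rw [eval_e, eval_e, lift_mul_eq_mul_lift hS]
  exact congr($this x)

theorem eval_L {n : ℕ} {Z : Fin d → Matrix (Fin n) (Fin n) ℂ} (hZ : Z ∈ ball d n) (k : Fin d)
    (x : Fock d) : eval (L k x) n Z = Z k * eval x n Z := by
  have : evalL hZ ∘L L k = mulLeftL (Z k) ∘L evalL hZ := clm_ext_e fun α => by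
    change eval (L k (e α)) n Z = Z k * eval (e α) n Z
    rw [L_e, eval_e, eval_e, map_mul, FreeMonoid.lift_eval_of]
  exact congr($this x)

theorem eval_lift_L {n : ℕ} {Z : Fin d → Matrix (Fin n) (Fin n) ℂ} (hZ : Z ∈ ball d n)
    (α : FreeMonoid (Fin d)) (x : Fock d) :
    eval (FreeMonoid.lift L α x) n Z = FreeMonoid.lift Z α * eval x n Z := by
  induction α using FreeMonoid.inductionOn' with
  | one => simp
  | of_mul k α ih =>
    simp only [map_mul, FreeMonoid.lift_eval_of, mul_apply_eq_comp]
    rw [eval_L hZ, ih, Matrix.mul_assoc]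

/-- A bounded operator which maps `e_α` to `e_α ⊗ a` is right multiplication by `a(Z)`. -/
theorem isRightProduct_eval {a : Fock d} {M : Fock d →L[ℂ] Fock d}
    (hM : ∀ α, M (e α) = FreeMonoid.lift L α a) (x : Fock d) :
    IsRightProduct (eval a) x (M x) := by
  intro n Z hZ
  have : evalL hZ ∘L M = mulRightL (eval a n Z) ∘L evalL hZ := clm_ext_e fun α => by
    change eval (M (e α)) n Z = eval (e α) n Z * eval a n Z
    rw [hM, eval_lift_L hZ, eval_e]
  exact congr($this x)

theorem eval_eq_add_sum {n : ℕ} {Z : Fin d → Matrix (Fin n) (Fin n) ℂ} (hZ : Z ∈ ball d n)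
    (x : Fock d) : eval x n Z = x 1 • 1 + ∑ k, Z k * eval (adjoint (L k) x) n Z := by
  conv_lhs => rw [eq_vac_add_sum_L x]
  rw [← evalL_apply hZ, map_add, map_sum, map_smul]
  simp only [evalL_apply, eval_L hZ, eval_e, map_one]

theorem eval_zero_point (n : ℕ) (x : Fock d) : eval x n 0 = x 1 • 1 := by
  rw [eval_eq_add_sum (zero_mem_ball d n)]
  simp

theorem apply_one_eq_zero_of_eval {x : Fock d} (h : eval x 1 0 = 0) : x 1 = 0 := by
  rw [eval_zero_point] at h
  simpa using congr($h 0 0)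

/-! ### Algebra of free functions, descent to L_k^*, and uniqueness of coefficients. -/

theorem IsFree.mul {F F' : NCMap d} (hF : IsFree F) (hF' : IsFree F') :
    IsFree fun n Z => F n Z * F' n Z := by
  intro n m Z hZ W hW S hS
  simp only
  rw [Matrix.mul_assoc, hF' n m Z hZ W hW S hS, ← Matrix.mul_assoc, hF n m Z hZ W hW S hS,
    Matrix.mul_assoc]

theorem IsFree.sub {F F' : NCMap d} (hF : IsFree F) (hF' : IsFree F') :
    IsFree fun n Z => F n Z - F' n Z := by
  intro n m Z hZ W hW S hS
  simp only
  rw [Matrix.sub_mul, Matrix.mul_sub, hF n m Z hZ W hW S hS, hF' n m Z hZ W hW S hS]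

/-- If `x(Z) F(Z) = y(Z)` and the vacuum coefficients of `x` and `y` vanish, then
`(L_k^* x)(Z) F(Z) = (L_k^* y)(Z)`. -/
theorem IsRightProduct.adjoint_L {F : NCMap d} (hF : IsFree F) {x y : Fock d}
    (h : IsRightProduct F x y) (hx : x 1 = 0) (hy : y 1 = 0) (k : Fin d) :
    IsRightProduct F (adjoint (L k) x) (adjoint (L k) y) := by
  intro n Z hZ
  refine sub_eq_zero.1 (eq_zero_of_sum_mul_eq_zero
    (g := fun k n Z => eval (adjoint (L k) y) n Z - eval (adjoint (L k) x) n Z * F n Z)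
    (fun k => (isFree_eval _).sub ((isFree_eval _).mul hF)) (fun n Z hZ => ?_) k n hZ)
  have := h n Z hZ
  rw [eval_eq_add_sum hZ x, eval_eq_add_sum hZ y, hx, hy] at this
  simp only [zero_smul, zero_add, Matrix.sum_mul] at this
  simp only [Matrix.mul_sub, Finset.sum_sub_distrib, this, Matrix.mul_assoc, sub_self]

theorem eq_zero_of_eval_eq_zero {x : Fock d} (h : ∀ n, ∀ Z ∈ ball d n, eval x n Z = 0) :
    x = 0 := by
  have hfree : IsFree (fun _ _ => 0 : NCMap d) := fun n m Z _ W _ S _ => by simp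
  ext β
  induction β using FreeMonoid.inductionOn' generalizing x with
  | one => exact apply_one_eq_zero_of_eval (h 1 0 (zero_mem_ball d 1))
  | of_mul k β ih =>
    have h0 := apply_one_eq_zero_of_eval (h 1 0 (zero_mem_ball d 1))
    -- Vanishing of x(Z) is encoded as x(Z)·0 = x(Z), so that descent to L_k^*x applies with the
    -- multiplier 0.
    have hp : IsRightProduct (fun _ _ => 0 : NCMap d) x x := fun n Z hZ => by
      simp [h n Z hZ]
    have := ih (x := adjoint (L k) x) fun n Z hZ => by
      simpa using hp.adjoint_L hfree h0 h0 k n Z hZ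
    simpa using this

theorem eval_injective {x y : Fock d} (h : ∀ n, ∀ Z ∈ ball d n, eval x n Z = eval y n Z) :
    x = y :=
  sub_eq_zero.1 <| eq_zero_of_eval_eq_zero fun n Z hZ => by
    rw [← evalL_apply hZ, map_sub, evalL_apply, evalL_apply, h n Z hZ, sub_self]

/-! ### Outer multipliers and right-Smirnov transformations -/

/-- The vectors whose value at Z is invertible form an open set containing the vacuum. The dense
range of M_A meets it, and an invertible product x(Z)A(Z) has an invertible factor A(Z). -/
theorem IsRightOuter.isUnit_det {A : NCMap d} (hA : IsRightOuter A) {n : ℕ}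
    {Z : Fin d → Matrix (Fin n) (Fin n) ℂ} (hZ : Z ∈ ball d n) : IsUnit (A n Z).det := by
  let U : Set (Fock d) := {x | (evalL hZ x).det ≠ 0}
  have hU : IsOpen U :=
    isOpen_ne_fun (evalL hZ).continuous.matrix_det continuous_const
  have hne : U.Nonempty := ⟨e 1, by simp [U, evalL_apply, eval_e]⟩
  obtain ⟨y, hy, x, hx⟩ := hA.dense.inter_open_nonempty U hU hne
  have hy' : (eval y n Z).det ≠ 0 := hy
  rw [hx n Z hZ, Matrix.det_mul] at hy'
  exact (right_ne_zero_of_mul hy').isUnit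

theorem IsRightOuter.isFree_inv {A : NCMap d} (hA : IsRightOuter A) :
    IsFree fun n Z => (A n Z)⁻¹ := by
  intro n m Z hZ W hW S hS
  have h := hA.multiplier.free n m Z hZ W hW S hS
  simp only
  calc (A n Z)⁻¹ * S = (A n Z)⁻¹ * (S * A m W) * (A m W)⁻¹ := by
        rw [Matrix.mul_assoc, Matrix.mul_nonsing_inv_cancel_right _ _ (hA.isUnit_det hW)]
    _ = S * (A m W)⁻¹ := by
        rw [← h, Matrix.nonsing_inv_mul_cancel_left _ _ (hA.isUnit_det hZ)]

theorem IsRightSmirnov.isLocal (h : IsRightSmirnov T) : IsLocal T := by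
  obtain ⟨-, A, B, hA, -, hdom, -⟩ := h
  intro x hx hx0 k
  rw [mem_ranL] at hx0
  rw [← SetLike.mem_coe, hdom] at hx ⊢
  obtain ⟨u, hu⟩ := hx
  refine ⟨adjoint (L k) u, hu.adjoint_L hA.multiplier.free ?_ hx0 k⟩
  apply apply_one_eq_zero_of_eval
  -- At Z = 0 only vacuum coefficients survive: u(0)A(0) = 0 with A(0) invertible gives u_∅ = 0.
  have h1 := hu 1 0 (zero_mem_ball d 1)
  rw [eval_zero_point, hx0, zero_smul] at h1
  rw [← Matrix.mul_nonsing_inv_cancel_right (A 1 0) (eval u 1 0)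
    (hA.isUnit_det (zero_mem_ball d 1)), ← h1, Matrix.zero_mul]

/-- Here x is the left factor, so y_∅ = 0 follows at Z = 0 directly; freeness of A⁻¹B permits the
descent. -/
theorem IsMaximalSmirnovMul.isLocal (h : IsMaximalSmirnovMul T) : IsLocal T := by
  obtain ⟨A, B, hA, hB, hdom, -⟩ := h
  intro x hx hx0 k
  rw [mem_ranL] at hx0
  obtain ⟨y, hy⟩ := (hdom x).1 hx
  refine (hdom _).2 ⟨adjoint (L k) y,
    hy.adjoint_L (hA.isFree_inv.mul hB.free) hx0 ?_ k⟩
  apply apply_one_eq_zero_of_eval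
  rw [hy 1 0 (zero_mem_ball d 1), eval_zero_point, hx0, zero_smul, Matrix.zero_mul]

theorem XstarVacSpans.isRightSmirnov (hT : LesssimR T) (hs : XstarVacSpans T hT.closed)
    (hd : IsDenselyDefined T) : IsRightSmirnov T := by
  obtain ⟨a, b, MA, MB, hMA, hMB, hG⟩ := hs.exists_parametrization hT
  have hmA : IsRightMultiplier (eval a) :=
    ⟨isFree_eval a, fun x => ⟨MA x, isRightProduct_eval hMA x⟩⟩
  have hmB : IsRightMultiplier (eval b) :=
    ⟨isFree_eval b, fun x => ⟨MB x, isRightProduct_eval hMB x⟩⟩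
  have hdom : (T.domain : Set (Fock d)) = ranMul (eval a) := by
    ext x
    constructor
    · intro hx
      obtain ⟨u, hu, -⟩ := (hG _).1 (graph_mem_G ⟨x, hx⟩)
      have hu' : x = MA u := hu
      exact ⟨u, hu' ▸ isRightProduct_eval hMA u⟩
    · rintro ⟨u, hu⟩
      -- The range of the multiplier is defined through values on the ball; uniqueness of
      -- coefficients turns it into the range of the operator `MA`.
      have hx : x = MA u := eval_injective fun n Z hZ => by
        rw [hu n Z hZ, isRightProduct_eval hMA u n Z hZ]
      obtain ⟨h, -⟩ := mem_G.1 ((hG (WithLp.toLp 2 (MA u, MB u))).2 ⟨u, rfl, rfl⟩)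
      rw [hx]
      exact h
  have hA : IsRightOuter (eval a) := ⟨hmA, hdom ▸ hd⟩
  refine ⟨hd, eval a, eval b, hA, hmB, hdom, fun x n Z hZ => ?_⟩
  obtain ⟨u, hu, hv⟩ := (hG _).1 (graph_mem_G x)
  have hu' : (x : Fock d) = MA u := hu
  have hv' : T x = MB u := hv
  rw [hv', hu', isRightProduct_eval hMA u n Z hZ, isRightProduct_eval hMB u n Z hZ, quot,
    ← Matrix.mul_assoc, Matrix.mul_nonsing_inv_cancel_right _ _ (hA.isUnit_det hZ)]

end FreeSmirnov

end

theorem corollary4p6 (d : ℕ) (T : FreeSmirnov.Fock d →ₗ.[ℂ] FreeSmirnov.Fock d)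
    (hT : FreeSmirnov.LesssimR T) :
    (FreeSmirnov.IsLocal T ↔ FreeSmirnov.XstarVacSpans T hT.closed) ∧
    (FreeSmirnov.IsDenselyDefined T →
      List.TFAE [FreeSmirnov.IsLocal T, FreeSmirnov.XstarVacSpans T hT.closed,
        FreeSmirnov.IsRightSmirnov T] ∧
      (FreeSmirnov.IsMaximalSmirnovMul T → FreeSmirnov.IsRightSmirnov T)) := by
  have h12 := FreeSmirnov.isLocal_iff_xstarVacSpans hT
  refine ⟨h12, fun hd => ⟨?_, fun hm => (h12.1 hm.isLocal).isRightSmirnov hT hd⟩⟩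
  tfae_have 1 ↔ 2 := h12
  tfae_have 2 → 3 := fun hs => hs.isRightSmirnov hT hd
  tfae_have 3 → 1 := fun h => h.isLocal
  tfae_finish
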